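/- Let $(V,\omega)$ be a smooth symplectic manifold of dimension $2n$ (without boundary) and let $W\subset V$ be a closed Lagrangian submanifold. Let $D=\{z\in\mathbb C: |z|\le 1\}$, let $1\le k\le\infty$, and let $u:D\to V$ be a $C^k$-map with $u(\partial D)\subset W$ that is contractible relative to $W$, i.e. there is a continuous map $H:[0,1]\times D\to V$ with $H(0,\cdot)=u$, $H(1,\cdot)$ constant, and $H(s,z)\in W$ for all $s\in[0,1]$, $z\in\partial D$. Let $\mathbb C^n$ carry the standard symplectic form $\sigma=-\operatorname{Im}(\cdot,\cdot)$, where $(v,w)=\sum_j v_j\bar w_j$, and let $\Lambda(n)$ be the manifold of all (nonoriented) Lagrangian subspaces of $\mathbb C^n$. The Maslov index of a loop $\Gamma:\partial D\to\Lambda(n)$ is the integer $m(\Gamma)$ with $[\Gamma]=m(\Gamma)\,e$ in $\pi_1(\Lambda(n))\cong\mathbb Z$ (for $n\ge1$), where $e$ is the generator represented by $e^{2\pi i t}\mapsto e^{\pi i t}\mathbb R\oplus\mathbb R^{n-1}$, $t\in[0,1]$; for $n=0$, $\Lambda(0)$ is a point and $m(\Gamma)=0$. Then the symplectic vector bundle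 $u^*TV$ over $D$ admits a continuous symplectic trivialization $\Phi:u^*TV\to D\times\mathbb C^n$. Moreover, for every such $\Phi$, the assignment $z\mapsto \Phi_z(T_{u(z)}W)$, $z\in\partial D$, is a continuous loop in $\Lambda(n)$, and its Maslov index is zero: $$m(u|_{\partial D})=0 .$$ -/

import Mathlib

open scoped Manifold ContDiff

noncomputable section

namespace SymplecticDisk

section Linear

/-- The space `ℂⁿ` with its standard Hermitian norm. -/
abbrev Cn (n : ℕ) : Type := EuclideanSpace ℂ (Fin n)

/-- The standard symplectic form `σ = - Im (·, ·)` of `ℂⁿ`, where `(v, w) = ∑ vⱼ * conj wⱼ`.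
Mathlib's inner product is conjugate-linear in the first variable, hence the sign; in real
coordinates `σ = ∑ dxⱼ ∧ dyⱼ`. -/
def stdSymp {n : ℕ} (v w : Cn n) : ℝ := (inner ℂ v w : ℂ).im

/-- A real subspace of `ℂⁿ` is Lagrangian if it has real dimension `n` and `σ` vanishes on it. -/
def IsLagrangian {n : ℕ} (L : Submodule ℝ (Cn n)) : Prop :=
  Module.finrank ℝ L = n ∧ ∀ v ∈ L, ∀ w ∈ L, stdSymp v w = 0

/-- The Lagrangian Grassmannian `Λ(n)` of all (nonoriented) Lagrangian subspaces of `ℂⁿ`. -/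
def LagrangianGrassmannian (n : ℕ) : Type := {L : Submodule ℝ (Cn n) // IsLagrangian L}

/-- The usual topology of the Grassmannian: a subspace is identified with the orthogonal
projection onto it (`ℂⁿ = ℝ²ⁿ` being a real Euclidean space for the scalar product
`Re (·, ·)`), and projections are compared in the space of real linear maps. -/
instance (n : ℕ) : TopologicalSpace (LagrangianGrassmannian n) :=
  TopologicalSpace.induced
    (fun L => (L.1.starProjection : Cn n →L[ℝ] Cn n)) inferInstance

/-- The real span of `e ^ (i θ) b₁, b₂, …, bₙ` for a unitary basis `b` of `ℂⁿ`. -/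
def turnedPlane {n : ℕ} (b : OrthonormalBasis (Fin n) ℂ (Cn n)) (θ : ℝ) :
    Submodule ℝ (Cn n) :=
  Submodule.span ℝ (Set.range fun j : Fin n =>
    (if (j : ℕ) = 0 then Complex.exp (θ * Complex.I) else 1) • b j)

/-- The loop `Γ` in `Λ(n)` has Maslov index `m`: its class is `m · e`, where `e` is the generator
of `π₁(Λ(n)) ≅ ℤ`. The class `m · e` is represented by the loop
`exp (2 π i t) ↦ ℝ e ^ (π i m t) b₁ ⊕ ℝ b₂ ⊕ … ⊕ ℝ bₙ`, for any unitary basis `b` of `ℂⁿ`; all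
choices of `b` give freely homotopic loops, as `U(n)` is connected. Loops are compared up to free
homotopy: as `Λ(n)` is path connected and `π₁(Λ(n))` is abelian, this is equality in
`π₁(Λ(n))`. -/
def HasMaslovIndex {n : ℕ} (Γ : C(Circle, LagrangianGrassmannian n)) (m : ℤ) : Prop :=
  ∃ (b : OrthonormalBasis (Fin n) ℂ (Cn n)) (e : C(Circle, LagrangianGrassmannian n)),
    (∀ t : ℝ, (e (Circle.exp (2 * Real.pi * t))).1 = turnedPlane b (Real.pi * m * t)) ∧
    Γ.Homotopic e

end Linear

section Manifold

variable {E : Type*} [NormedAddCommGroup E] [NormedSpace ℝ E]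
  {V : Type*} [TopologicalSpace V] [ChartedSpace E V]

/-- The expression in the preferred chart at `x₀` of a field `Ω` of alternating bilinear forms on
the tangent spaces of `V`, i.e. the pullback of `Ω` by the inverse of the chart. It is meaningful
on the target of the chart. -/
def formInChart (Ω : ∀ x : V, TangentSpace 𝓘(ℝ, E) x [⋀^Fin 2]→L[ℝ] ℝ) (x₀ : V) (y : E) :
    E [⋀^Fin 2]→L[ℝ] ℝ :=
  (Ω ((extChartAt 𝓘(ℝ, E) x₀).symm y)).compContinuousLinearMap
    (mfderiv 𝓘(ℝ, E) 𝓘(ℝ, E) (extChartAt 𝓘(ℝ, E) x₀).symm y)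

/-- Symplectic forms on a manifold without boundary: smooth closed nondegenerate `2`-forms. -/
structure IsSymplecticForm (Ω : ∀ x : V, TangentSpace 𝓘(ℝ, E) x [⋀^Fin 2]→L[ℝ] ℝ) : Prop where
  smooth : ∀ x₀ : V, ContDiffOn ℝ ∞ (formInChart Ω x₀) (extChartAt 𝓘(ℝ, E) x₀).target
  closed : ∀ x₀ : V, ∀ y ∈ (extChartAt 𝓘(ℝ, E) x₀).target, extDeriv (formInChart Ω x₀) y = 0
  nondegenerate : ∀ (x : V) (v : TangentSpace 𝓘(ℝ, E) x), (∀ w, Ω x ![v, w] = 0) → v = 0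

variable {F : Type*} [NormedAddCommGroup F] [NormedSpace ℝ F]
  {W : Type*} [TopologicalSpace W] [ChartedSpace F W]

/-- `ι : W → V` is a smooth embedding onto a closed Lagrangian submanifold of `(V, Ω)`. -/
structure IsClosedLagrangian (Ω : ∀ x : V, TangentSpace 𝓘(ℝ, E) x [⋀^Fin 2]→L[ℝ] ℝ)
    (ι : W → V) : Prop where
  embedding : Manifold.IsSmoothEmbedding 𝓘(ℝ, F) 𝓘(ℝ, E) ∞ ι
  isClosed_range : IsClosed (Set.range ι)
  half_dim : Module.finrank ℝ E = 2 * Module.finrank ℝ F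
  isotropic : ∀ (w : W) (a b : TangentSpace 𝓘(ℝ, F) w),
    Ω (ι w) ![mfderiv 𝓘(ℝ, F) 𝓘(ℝ, E) ι w a, mfderiv 𝓘(ℝ, F) 𝓘(ℝ, E) ι w b] = 0

/-- The tangent space at `x` of the submanifold `ι(W)`, as a subset of `T_x V`: the vectors at `x`
that lie in the image `TW ⊆ TV` of the differential of `ι`. -/
def tangentOfRange (ι : W → V) (x : V) : Set (TangentSpace 𝓘(ℝ, E) x) :=
  {v | (⟨x, v⟩ : TangentBundle 𝓘(ℝ, E) V) ∈ Set.range (tangentMap 𝓘(ℝ, F) 𝓘(ℝ, E) ι)}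

/-- The closed unit disk `D` of the plane. -/
abbrev Disk : Type := Metric.closedBall (0 : ℂ) 1

/-- A point of the unit circle, as a boundary point of the disk. -/
def bdry (z : Circle) : Disk := ⟨(z : ℂ), by simp [Circle.norm_coe]⟩

/-- The map `u` of the closed unit disk is contractible in `V` relative to `S ⊆ V`: it is homotopic
to a constant map through maps of pairs `(D, ∂D) → (V, S)`. -/
def ContractibleRel (u : ℂ → V) (S : Set V) : Prop :=
  ∃ (H : C(unitInterval × Disk, V)) (p : V),
    (∀ z : Disk, H (0, z) = u z) ∧ (∀ z : Disk, H (1, z) = p) ∧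
    ∀ (s : unitInterval) (z : Circle), H (s, bdry z) ∈ S

/-- A trivialization `Φ` of the symplectic vector bundle `u^* TV` over the closed unit disk, that
is, an isomorphism of symplectic vector bundles from `u^* TV` to `D × ℂⁿ`. Its inverse is a
continuous bundle map `D × ℂⁿ → TV` over `u`. -/
structure SymplecticTrivialization [IsManifold 𝓘(ℝ, E) 1 V] (n : ℕ)
    (Ω : ∀ x : V, TangentSpace 𝓘(ℝ, E) x [⋀^Fin 2]→L[ℝ] ℝ) (u : ℂ → V) where
  /-- the linear isomorphism on the fibre over `z` -/
  equiv : ∀ z : Disk, TangentSpace 𝓘(ℝ, E) (u z) ≃ₗ[ℝ] Cn n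
  continuous_symm : Continuous fun q : Disk × Cn n =>
    (⟨u q.1, (equiv q.1).symm q.2⟩ : TangentBundle 𝓘(ℝ, E) V)
  symplectic : ∀ (z : Disk) (v w : TangentSpace 𝓘(ℝ, E) (u z)),
    stdSymp (equiv z v) (equiv z w) = Ω (u z) ![v, w]

/-- `Γ` is the loop `z ↦ Φ_z (T_{u(z)} W)` of Lagrangian subspaces of `ℂⁿ` that the Lagrangian
subbundle `(u|_{∂D})^* TW` of `u^* TV` becomes in the trivialization `Φ`. -/
def IsBoundaryLoop [IsManifold 𝓘(ℝ, E) 1 V] {n : ℕ}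
    {Ω : ∀ x : V, TangentSpace 𝓘(ℝ, E) x [⋀^Fin 2]→L[ℝ] ℝ}
    {u : ℂ → V}
    (Φ : SymplecticTrivialization n Ω u) (ι : W → V)
    (Γ : C(Circle, LagrangianGrassmannian n)) : Prop :=
  ∀ z : Circle, ((Γ z).1 : Set (Cn n)) =
    Φ.equiv (bdry z) '' tangentOfRange (E := E) (F := F) ι (u (bdry z))

end Manifold

end SymplecticDisk

end

/-! Let `H` be the contraction of `u`. The cylinder `[0,1] × D` is compact and contractible, so
`H^*TV` is symplectically trivial over it (`exists_symplectic_frame`); the slice `s = 0` gives a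
trivialization of `u^*TV`. A given `Φ` differs from that one by a continuous family of symplectic
maps over `D`; using the same family at every `s` extends `Φ` to the cylinder. In the extended
trivialization the tangent planes of `W` along `[0,1] × ∂D` (`exists_lagrangian_family`) form a free
homotopy from the boundary loop of `u` to the loop at `s = 1`. There `H` is a constant `p`, so the
plane `T_p W` is fixed and only the trivialization varies with `z`. Since the trivialization is
defined on the whole disk, shrinking the circle to a point makes the loop constant, and a constant
loop has index `0`.

For the triviality, a map to `ℝᴺ` that is immersive on the compact image of `H` turns the fibres
into ranges of projections. Homotopic families of idempotents are conjugate
(`exists_conj_idempotents`), which gives a linear frame; homotopic families of symplectic forms are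
isomorphic (`exists_equiv_forms`), which makes the form constant in a corrected frame; a Lagrangian
subspace of one fibre then identifies the model with `ℂⁿ` (`exists_symplectic_equiv`). -/

noncomputable section

namespace SymplecticDisk

open Topology Filter

/-! ### Continuity of orthogonal projections onto the ranges of injective families. -/

section Projections

variable {X F G : Type*} [TopologicalSpace X]
  [NormedAddCommGroup F] [NormedSpace ℝ F] [FiniteDimensional ℝ F]
  [NormedAddCommGroup G] [InnerProductSpace ℝ G] [FiniteDimensional ℝ G]

/-- Inversion of continuous linear maps is continuous at invertible maps, in the form needed for
families. -/
theorem continuousAt_clm_inverse {M N : Type*} [NormedAddCommGroup M] [NormedSpace ℝ M]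
    [CompleteSpace M] [NormedAddCommGroup N] [NormedSpace ℝ N] {D : X → M →L[ℝ] N} {x₀ : X}
    (hD : ContinuousAt D x₀) (h : (D x₀).IsInvertible) :
    ContinuousAt (fun x => (D x).inverse) x₀ :=
  ContinuousAt.comp (f := D) (g := ContinuousLinearMap.inverse)
    (h.contDiffAt_map_inverse (n := 0)).continuousAt hD

theorem eventually_isInvertible {M N : Type*} [NormedAddCommGroup M] [NormedSpace ℝ M]
    [CompleteSpace M] [NormedAddCommGroup N] [NormedSpace ℝ N] {D : X → M →L[ℝ] N} {x₀ : X}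
    (hD : ContinuousAt D x₀) (h : (D x₀).IsInvertible) :
    ∀ᶠ x in 𝓝 x₀, (D x).IsInvertible := by
  obtain ⟨e, he⟩ := h
  have : ∀ᶠ A in 𝓝 (D x₀), A ∈ Set.range ((↑) : (M ≃L[ℝ] N) → M →L[ℝ] N) := by
    rw [← he]; exact ContinuousLinearEquiv.nhds e
  filter_upwards [hD.eventually this] with x hx
  exact hx

/-- A continuous family of injective linear maps has a continuous family of left inverses
near each point, which moreover computes the orthogonal projections onto the ranges. -/
theorem exists_left_inverse_family {D : X → F →L[ℝ] G} {x₀ : X} (hD : ContinuousAt D x₀)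
    (hinj : Function.Injective (D x₀)) :
    ∃ Q : X → G →L[ℝ] F, ContinuousAt Q x₀ ∧
      ∀ᶠ x in 𝓝 x₀, (Q x ∘L D x = ContinuousLinearMap.id ℝ F) ∧
        D x ∘L Q x = (LinearMap.range (D x).toLinearMap).starProjection := by
  -- Euclidean coordinates on `F` make adjoints available. The left inverse is the Moore–Penrose
  -- one, `(A D')⁻¹ A` with `A` the adjoint of `D'`.
  let e : F ≃L[ℝ] EuclideanSpace ℝ (Fin (Module.finrank ℝ F)) := toEuclidean
  let D' : X → EuclideanSpace ℝ (Fin (Module.finrank ℝ F)) →L[ℝ] G := fun x =>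
    D x ∘L (e.symm : _ →L[ℝ] F)
  have hD' : ContinuousAt D' x₀ := hD.clm_comp continuousAt_const
  let A : X → G →L[ℝ] EuclideanSpace ℝ (Fin (Module.finrank ℝ F)) := fun x =>
    ContinuousLinearMap.adjoint (D' x)
  have hA : ContinuousAt A x₀ :=
    (ContinuousLinearMap.adjoint (𝕜 := ℝ) (E := EuclideanSpace ℝ (Fin (Module.finrank ℝ F)))
      (F := G)).continuous.continuousAt.comp hD'
  have hAD : ContinuousAt (fun x => A x ∘L D' x) x₀ := hA.clm_comp hD'
  have hinv : (A x₀ ∘L D' x₀).IsInvertible := by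
    have hi : Function.Injective (A x₀ ∘L D' x₀).toLinearMap := by
      rw [injective_iff_map_eq_zero]
      intro v hv
      have h1 : inner ℝ (D' x₀ v) (D' x₀ v) = 0 := by
        have h2 : A x₀ (D' x₀ v) = 0 := hv
        rw [← ContinuousLinearMap.adjoint_inner_right]
        change inner ℝ v (A x₀ (D' x₀ v)) = 0
        rw [h2, inner_zero_right]
      have h3 : D x₀ (e.symm v) = 0 := inner_self_eq_zero.1 h1
      have h4 : e.symm v = 0 := hinj (by rw [h3, map_zero])
      simpa using h4
    exact ⟨(LinearEquiv.ofInjectiveEndo _ hi).toContinuousLinearEquiv, by ext; rfl⟩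
  refine ⟨fun x => (e.symm : _ →L[ℝ] F) ∘L ((A x ∘L D' x).inverse ∘L A x),
    continuousAt_const.clm_comp ((continuousAt_clm_inverse hAD hinv).clm_comp hA), ?_⟩
  filter_upwards [eventually_isInvertible hAD hinv] with x hx
  have hx1 : ∀ v, (A x ∘L D' x).inverse (A x (D' x v)) = v := fun v =>
    DFunLike.congr_fun hx.inverse_comp_self v
  have hx2 : ∀ v, A x (D' x ((A x ∘L D' x).inverse v)) = v := fun v =>
    DFunLike.congr_fun hx.self_comp_inverse v
  constructor
  · ext v
    have := hx1 (e v)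
    simp only [D', ContinuousLinearMap.coe_comp, Function.comp_apply,
      ContinuousLinearEquiv.coe_coe, ContinuousLinearEquiv.symm_apply_apply] at this ⊢
    rw [this]; simp
  · ext g
    refine (Submodule.eq_starProjection_of_mem_orthogonal ?_ ?_).symm
    · exact ⟨_, rfl⟩
    · rw [Submodule.mem_orthogonal']
      rintro _ ⟨v, rfl⟩
      have h5 : D x v = D' x (e v) := by simp [D']
      change inner ℝ (g - D' x ((A x ∘L D' x).inverse (A x g))) (D x v) = 0
      rw [h5, ← ContinuousLinearMap.adjoint_inner_left]
      change inner ℝ (A x _) (e v) = 0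
      rw [map_sub, hx2, sub_self, inner_zero_left]

theorem continuousAt_starProjection {D : X → F →L[ℝ] G} {x₀ : X} (hD : ContinuousAt D x₀)
    (hinj : Function.Injective (D x₀)) {S : X → Submodule ℝ G}
    (hS : ∀ᶠ x in 𝓝 x₀, S x = LinearMap.range (D x).toLinearMap) :
    ContinuousAt (fun x => (S x).starProjection) x₀ := by
  obtain ⟨Q, hQ, h⟩ := exists_left_inverse_family hD hinj
  refine (hD.clm_comp hQ).congr ?_
  filter_upwards [h, hS] with x hx hx'
  rw [hx', hx.2]

end Projections

/-! ### Conjugation of idempotents and square roots in Banach algebras. -/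

section Transport

theorem exists_continuous_units {X : Type*} [TopologicalSpace X] {R : Type*} [NormedRing R]
    [CompleteSpace R] {f : X → R}
    (hf : Continuous f) (hu : ∀ x, IsUnit (f x)) :
    ∃ τ : X → Rˣ, Continuous τ ∧ ∀ x, (τ x : R) = f x := by
  choose τ hτ using hu
  refine ⟨τ, ?_, hτ⟩
  rw [Units.isOpenEmbedding_val.isEmbedding.continuous_iff]
  exact hf.congr fun x => (hτ x).symm

variable {X : Type*} [TopologicalSpace X] [CompactSpace X]

/-- Homotopic families of idempotents over a compact space are conjugate. -/
theorem exists_conj_idempotents {R : Type*} [NormedRing R] [CompleteSpace R]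
    {P : unitInterval × X → R} (hP : Continuous P) (hid : ∀ q, P q * P q = P q) :
    ∃ τ : X → Rˣ, Continuous τ ∧ ∀ x, (τ x : R) * P (0, x) = P (1, x) * τ x := by
  -- The relation is symmetric, transitive and holds for nearby parameters, so connectedness of the
  -- interval yields it for `0` and `1`.
  let r : unitInterval → unitInterval → Prop := fun s t =>
    ∃ τ : X → Rˣ, Continuous τ ∧ ∀ x, (τ x : R) * P (s, x) = P (t, x) * τ x
  have : Std.Symm r := ⟨by
    rintro s t ⟨τ, hτ, h⟩
    refine ⟨fun x => (τ x)⁻¹, hτ.inv, fun x => ?_⟩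
    have := congrArg (fun y => (↑(τ x)⁻¹ : R) * y * (↑(τ x)⁻¹ : R)) (h x)
    simpa [mul_assoc] using this.symm⟩
  refine PreconnectedSpace.induction₂ r (fun s => ?_) ⟨?_⟩ 0 1
  -- `U` satisfies `U P_s = P_t P_s = P_t U` and equals `1` at `t = s`; by compactness of `X` it is
  -- invertible for all `x` at once when `t` is near `s`.
  · let U : unitInterval × X → R := fun q =>
      P q * P (s, q.2) + (1 - P q) * (1 - P (s, q.2))
    have hU : Continuous U := by fun_prop
    have hU1 : ∀ x, U (s, x) = 1 := fun x => by
      have := hid (s, x)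
      simp only [U, mul_sub, sub_mul, this]; simp
    have hev : ∀ᶠ t in 𝓝 s, ∀ x ∈ (Set.univ : Set X), IsUnit (U (t, x)) := by
      refine isCompact_univ.eventually_forall_of_forall_eventually fun x _ => ?_
      refine hU.continuousAt.eventually (p := fun y => IsUnit y) ?_
      rw [hU1]
      exact Units.isOpen.mem_nhds isUnit_one
    filter_upwards [hev] with t ht
    obtain ⟨τ, hτ, h⟩ := exists_continuous_units (f := fun x => U (t, x)) (by fun_prop)
      fun x => ht x trivial
    refine ⟨τ, hτ, fun x => ?_⟩
    have h1 := hid (s, x)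
    have h2 := hid (t, x)
    rw [h]
    simp only [U, add_mul, mul_add, mul_assoc, h1, sub_mul, mul_sub, one_mul, mul_one]
    simp only [← mul_assoc, h2]
    simp
  · rintro s t v ⟨τ, hτ, h⟩ ⟨τ', hτ', h'⟩
    refine ⟨fun x => τ' x * τ x, hτ'.mul hτ, fun x => ?_⟩
    rw [Units.val_mul, mul_assoc, h, ← mul_assoc, h', mul_assoc]

/-- Based on `c² - c'² = c (c - c') + (c - c') c'`. With `d = d'` it is the contraction estimate;
for fixed points it gives Lipschitz dependence on `d`. -/
theorem norm_half_add_sq_sub_le {R : Type*} [NormedRing R] [NormedAlgebra ℝ R] {c c' d d' : R}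
    (hc : ‖c‖ ≤ 1 / 2) (hc' : ‖c'‖ ≤ 1 / 2) :
    ‖(1 / 2 : ℝ) • (d + c * c) - (1 / 2 : ℝ) • (d' + c' * c')‖ ≤
      1 / 2 * ‖d - d'‖ + 1 / 2 * ‖c - c'‖ := by
  have h1 : (1 / 2 : ℝ) • (d + c * c) - (1 / 2 : ℝ) • (d' + c' * c') =
      (1 / 2 : ℝ) • ((d - d') + (c * (c - c') + (c - c') * c')) := by
    rw [← smul_sub]; congr 1; noncomm_ring
  rw [h1, norm_smul]
  have h2 : ‖c * (c - c') + (c - c') * c'‖ ≤ ‖c - c'‖ := by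
    refine (norm_add_le _ _).trans ?_
    have := norm_mul_le c (c - c')
    have := norm_mul_le (c - c') c'
    nlinarith [norm_nonneg (c - c')]
  have h3 := norm_add_le (d - d') (c * (c - c') + (c - c') * c')
  rw [Real.norm_of_nonneg (by norm_num)]
  linarith

/-- Banach's fixed point theorem on the part of `S` in the ball of radius `1/2`. The equation says
`(1 - c)² = 1 - d`, so `1 - c` is a square root. -/
theorem exists_half_add_sq {R : Type*} [NormedRing R] [NormedAlgebra ℝ R] [CompleteSpace R]
    (S : Submodule ℝ R) (hS : IsClosed (S : Set R)) (hSS : ∀ a ∈ S, a * a ∈ S) {d : R}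
    (hdS : d ∈ S) (hd : ‖d‖ ≤ 1 / 2) :
    ∃ c ∈ S, ‖c‖ ≤ 1 / 2 ∧ (1 / 2 : ℝ) • (d + c * c) = c := by
  let f : R → R := fun c => (1 / 2 : ℝ) • (d + c * c)
  let s : Set R := S ∩ Metric.closedBall 0 (1 / 2)
  have hs : IsClosed s := hS.inter Metric.isClosed_closedBall
  have hmaps : Set.MapsTo f s s := by
    rintro c ⟨hcS, hc⟩
    have hc : ‖c‖ ≤ 1 / 2 := by simpa using hc
    refine ⟨S.smul_mem _ (S.add_mem hdS (hSS c hcS)), ?_⟩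
    rw [mem_closedBall_zero_iff]
    have h1 := norm_mul_le c c
    have h2 := norm_add_le d (c * c)
    simp only [f]
    rw [norm_smul, Real.norm_of_nonneg (by norm_num)]
    nlinarith [norm_nonneg c]
  have hcon : ContractingWith (1 / 2) (hmaps.restrict f s s) := by
    refine ⟨by norm_num, LipschitzWith.of_dist_le_mul ?_⟩
    rintro ⟨c, hcS, hc⟩ ⟨c', hcS', hc'⟩
    have hc : ‖c‖ ≤ 1 / 2 := by simpa using hc
    have hc' : ‖c'‖ ≤ 1 / 2 := by simpa using hc'
    rw [Subtype.dist_eq, Subtype.dist_eq, dist_eq_norm, dist_eq_norm]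
    have := norm_half_add_sq_sub_le (d := d) (d' := d) hc hc'
    simpa [f] using this
  obtain ⟨c, hc, hfc, -⟩ := hcon.exists_fixedPoint' hs.isComplete hmaps (x := 0)
    ⟨S.zero_mem, by simp⟩ (edist_ne_top _ _)
  exact ⟨c, hc.1, by simpa using hc.2, hfc⟩

/-- A continuous square root near the identity of a Banach algebra, which preserves all closed
subspaces that are stable under squaring. -/
theorem exists_sqrt_near_one (R : Type*) [NormedRing R] [NormedAlgebra ℝ R] [CompleteSpace R] :
    ∃ g : R → R, ContinuousOn g (Metric.closedBall 1 (1 / 2)) ∧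
      ∀ b ∈ Metric.closedBall (1 : R) (1 / 2), g b * g b = b ∧ IsUnit (g b) ∧
        ∀ S : Submodule ℝ R, IsClosed (S : Set R) → 1 ∈ S → (∀ a ∈ S, a * a ∈ S) → b ∈ S →
          g b ∈ S := by
  have hex : ∀ d : R, ‖d‖ ≤ 1 / 2 → ∃ c : R, ‖c‖ ≤ 1 / 2 ∧ (1 / 2 : ℝ) • (d + c * c) = c :=
    fun d hd => by
      obtain ⟨c, -, h⟩ := exists_half_add_sq (⊤ : Submodule ℝ R) isClosed_univ (by simp)
        (Submodule.mem_top (x := d)) hd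
      exact ⟨c, h⟩
  choose! c hc hfc using hex
  have hlip : ∀ d d' a a' : R, ‖a‖ ≤ 1 / 2 → ‖a'‖ ≤ 1 / 2 → (1 / 2 : ℝ) • (d + a * a) = a →
      (1 / 2 : ℝ) • (d' + a' * a') = a' → ‖a - a'‖ ≤ ‖d - d'‖ := by
    intro d d' a a' ha ha' h h'
    have := norm_half_add_sq_sub_le (d := d) (d' := d') ha ha'
    rw [h, h'] at this
    linarith
  have hmem : ∀ b ∈ Metric.closedBall (1 : R) (1 / 2), ‖1 - b‖ ≤ 1 / 2 := fun b hb => by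
    rwa [mem_closedBall_iff_norm'] at hb
  refine ⟨fun b => 1 - c (1 - b), ?_, fun b hb => ⟨?_, ?_, ?_⟩⟩
  · have : LipschitzOnWith 1 (fun b => 1 - c (1 - b)) (Metric.closedBall 1 (1 / 2)) := by
      refine LipschitzOnWith.of_dist_le_mul fun b hb b' hb' => ?_
      have := hlip _ _ _ _ (hc _ (hmem b' hb')) (hc _ (hmem b hb)) (hfc _ (hmem b' hb'))
        (hfc _ (hmem b hb))
      rw [dist_eq_norm, dist_eq_norm]
      simpa using this
    exact this.continuousOn
  · have h := congrArg (fun y => (2 : ℝ) • y) (hfc _ (hmem b hb))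
    simp only [smul_smul] at h
    norm_num at h
    have h2 : c (1 - b) * c (1 - b) = (2 : ℝ) • c (1 - b) - (1 - b) := by rw [← h]; abel
    rw [two_smul] at h2
    simp only [mul_sub, sub_mul, h2, one_mul, mul_one]
    abel
  · exact isUnit_one_sub_of_norm_lt_one ((hc _ (hmem b hb)).trans_lt (by norm_num))
  -- The fixed point found inside `S` agrees with the chosen one by the Lipschitz estimate, which
  -- includes uniqueness.
  · intro S hS h1 hSS hbS
    obtain ⟨a, haS, ha, hfa⟩ := exists_half_add_sq S hS hSS (S.sub_mem h1 hbS) (hmem b hb)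
    have := hlip _ _ _ _ ha (hc _ (hmem b hb)) hfa (hfc _ (hmem b hb))
    rw [sub_self, norm_zero, norm_le_zero_iff, sub_eq_zero] at this
    exact S.sub_mem h1 (this ▸ haS)

end Transport

/-! ### Linear symplectic algebra and Lagrangian subspaces. -/

section Forms

variable {E : Type*} [NormedAddCommGroup E] [NormedSpace ℝ E] [FiniteDimensional ℝ E]

theorem isInvertible_of_nondegenerate {η : E →L[ℝ] E →L[ℝ] ℝ}
    (hη : ∀ v, (∀ w, η v w = 0) → v = 0) : η.IsInvertible := by
  have hi : Function.Injective η.toLinearMap := by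
    rw [injective_iff_map_eq_zero]
    intro v hv
    refine hη v fun w => ?_
    have : η v = 0 := hv
    rw [this]; rfl
  have hdim : Module.finrank ℝ E = Module.finrank ℝ (E →L[ℝ] ℝ) := by
    rw [← (LinearMap.toContinuousLinearMap (𝕜 := ℝ) (E := E) (F' := ℝ)).finrank_eq]
    exact Subspace.dual_finrank_eq.symm
  exact ⟨(LinearEquiv.ofInjectiveOfFinrankEq _ hi hdim).toContinuousLinearEquiv, by ext; rfl⟩

/-- The endomorphisms that are self-adjoint for the bilinear form `η`. -/
def formSelfAdjoint (η : E →L[ℝ] E →L[ℝ] ℝ) : Submodule ℝ (E →L[ℝ] E) where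
  carrier := {a | ∀ v w, η (a v) w = η v (a w)}
  add_mem' ha hb v w := by simp [ha v w, hb v w]
  zero_mem' v w := by simp
  smul_mem' c a ha v w := by simp [ha v w]

omit [FiniteDimensional ℝ E] in
theorem isClosed_formSelfAdjoint (η : E →L[ℝ] E →L[ℝ] ℝ) :
    IsClosed (formSelfAdjoint η : Set (E →L[ℝ] E)) := by
  have : (formSelfAdjoint η : Set (E →L[ℝ] E)) =
      ⋂ v, ⋂ w, {a | η (a v) w = η v (a w)} := by
    ext a; simp [formSelfAdjoint]
  rw [this]
  exact isClosed_iInter fun v => isClosed_iInter fun w =>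
    isClosed_eq (by fun_prop) (by fun_prop)

/-- Homotopic families of symplectic forms on a vector space over a compact space are
isomorphic. -/
theorem exists_equiv_forms {X : Type*} [TopologicalSpace X] [CompactSpace X]
    {η : unitInterval × X → E →L[ℝ] E →L[ℝ] ℝ} (hη : Continuous η)
    (halt : ∀ q v, η q v v = 0) (hnd : ∀ q v, (∀ w, η q v w = 0) → v = 0) :
    ∃ τ : X → (E →L[ℝ] E)ˣ, Continuous τ ∧
      ∀ x v w, η (0, x) ((τ x : E →L[ℝ] E) v) ((τ x : E →L[ℝ] E) w) = η (1, x) v w := by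
  have hskew : ∀ q v w, η q v w = - η q w v := fun q v w => by
    have := halt q (v + w)
    simp only [map_add, add_apply, halt] at this
    linarith
  let r : unitInterval → unitInterval → Prop := fun s t =>
    ∃ τ : X → (E →L[ℝ] E)ˣ, Continuous τ ∧
      ∀ x v w, η (s, x) ((τ x : E →L[ℝ] E) v) ((τ x : E →L[ℝ] E) w) = η (t, x) v w
  have : Std.Symm r := ⟨by
    rintro s t ⟨τ, hτ, h⟩
    refine ⟨fun x => (τ x)⁻¹, hτ.inv, fun x v w => ?_⟩
    have h1 : ∀ v, (τ x : E →L[ℝ] E) ((↑(τ x)⁻¹ : E →L[ℝ] E) v) = v := fun v =>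
      DFunLike.congr_fun (τ x).mul_inv v
    rw [← h, h1, h1]⟩
  refine PreconnectedSpace.induction₂ r (fun s => ?_) ⟨?_⟩ 0 1
  · obtain ⟨g, hg, hgb⟩ := exists_sqrt_near_one (E →L[ℝ] E)
    have hinv : ∀ x, (η (s, x)).IsInvertible := fun x => isInvertible_of_nondegenerate (hnd _)
    -- `B = η_s⁻¹ η_t` is `η_s`-self-adjoint and near `1`. Its square root `g` is self-adjoint too,
    -- so `η_s (g v, g w) = η_s (g² v, w) = η_t (v, w)`.
    let B : unitInterval × X → E →L[ℝ] E := fun q => (η (s, q.2)).inverse ∘L η q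
    have hB : Continuous B := by
      refine Continuous.clm_comp ?_ hη
      rw [continuous_iff_continuousAt]
      intro q
      have : Continuous fun q : unitInterval × X => η (s, q.2) := by fun_prop
      exact continuousAt_clm_inverse this.continuousAt (hinv q.2)
    have hBη : ∀ q v, η (s, q.2) (B q v) = η q v := fun q v =>
      DFunLike.congr_fun (hinv q.2).self_comp_inverse (η q v)
    have hB1 : ∀ x, B (s, x) = 1 := fun x => (hinv x).inverse_comp_self
    have hev : ∀ᶠ t in 𝓝 s, ∀ x ∈ (Set.univ : Set X), B (t, x) ∈ Metric.closedBall 1 (1 / 2) := by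
      refine isCompact_univ.eventually_forall_of_forall_eventually fun x _ => ?_
      refine hB.continuousAt.eventually (p := fun y => y ∈ Metric.closedBall 1 (1 / 2)) ?_
      rw [hB1]
      exact Metric.closedBall_mem_nhds _ (by norm_num)
    filter_upwards [hev] with t ht
    obtain ⟨τ, hτ, h⟩ := exists_continuous_units (f := fun x => g (B (t, x)))
      (hg.comp_continuous (by fun_prop) fun x => ht x trivial) fun x => (hgb _ (ht x trivial)).2.1
    refine ⟨τ, hτ, fun x v w => ?_⟩
    obtain ⟨h1, -, h2⟩ := hgb _ (ht x trivial)
    have h3 := h2 (formSelfAdjoint (η (s, x))) (isClosed_formSelfAdjoint _) (fun v w => rfl)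
      (fun a ha v w => (ha _ _).trans (ha _ _)) (fun v w => by
        rw [hBη (t, x), hskew, ← hBη (t, x), hskew, neg_neg])
    rw [h, ← h3, ← hBη (t, x)]
    congr 2
    exact DFunLike.congr_fun h1 v
  · rintro s t v ⟨τ, hτ, h⟩ ⟨τ', hτ', h'⟩
    refine ⟨fun x => τ x * τ' x, hτ.mul hτ', fun x a b => ?_⟩
    rw [← h', ← h]; rfl

theorem stdSymp_eq_sum {n : ℕ} (v w : Cn n) :
    stdSymp v w = ∑ j, ((v j).re * (w j).im - (v j).im * (w j).re) := by
  simp only [stdSymp, PiLp.inner_apply, Complex.im_sum]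
  refine Finset.sum_congr rfl fun j _ => ?_
  simp; ring

theorem finrank_Cn (n : ℕ) : Module.finrank ℝ (Cn n) = 2 * n := by
  rw [finrank_real_of_complex, finrank_euclideanSpace_fin]

/-- A symplectic vector space that contains a Lagrangian subspace is isomorphic to `ℂⁿ`. -/
theorem exists_symplectic_equiv {n : ℕ} {F : Type*} [AddCommGroup F] [Module ℝ F]
    [FiniteDimensional ℝ F] (hE : Module.finrank ℝ E = 2 * n) (hF : Module.finrank ℝ F = n)
    {η : E →L[ℝ] E →L[ℝ] ℝ} (halt : ∀ v, η v v = 0) (hnd : ∀ v, (∀ w, η v w = 0) → v = 0)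
    (l : F →ₗ[ℝ] E) (hl : Function.Injective l) (hiso : ∀ a b, η (l a) (l b) = 0) :
    ∃ T : Cn n ≃ₗ[ℝ] E, ∀ v w, η (T v) (T w) = stdSymp v w := by
  have hskew : ∀ v w, η v w = - η w v := fun v w => by
    have := halt (v + w)
    simp only [map_add, add_apply, halt] at this
    linarith
  let b : Module.Basis (Fin n) ℝ F := (Module.finBasis ℝ F).reindex (finCongr hF)
  -- Vectors dual to the Lagrangian basis: extend a coordinate functional from `F` to `E` and
  -- represent it by `η`.
  have hm : ∀ j, ∃ m : E, ∀ i, η (l (b i)) m = if i = j then 1 else 0 := fun j => by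
    obtain ⟨φ, hφ⟩ := LinearMap.dualMap_surjective_of_injective hl (b.coord j)
    obtain ⟨e, he⟩ := isInvertible_of_nondegenerate hnd
    refine ⟨- e.symm (LinearMap.toContinuousLinearMap φ), fun i => ?_⟩
    rw [hskew, map_neg, neg_apply, neg_neg, ← he,
      ContinuousLinearEquiv.coe_coe, ContinuousLinearEquiv.apply_symm_apply]
    change l.dualMap φ (b i) = _
    rw [hφ, Module.Basis.coord_apply, Module.Basis.repr_self, Finsupp.single_apply]
  choose m hm using hm
  have hm' : ∀ i j, η (m i) (l (b j)) = if j = i then -1 else 0 := fun i j => by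
    rw [hskew, hm]; split_ifs <;> simp
  -- Adding Lagrangian vectors keeps the duality; the factor `1/2` is right because the two
  -- corrections of `η (m i) (m j)` each contribute `-1/2` of it.
  let m' : Fin n → E := fun i => m i + ∑ k, (-(1 / 2) * η (m i) (m k)) • l (b k)
  have h1 : ∀ i j, η (l (b i)) (m' j) = if i = j then 1 else 0 := fun i j => by
    simp [m', hm, hiso]
  have h2 : ∀ i j, η (m' i) (m' j) = 0 := fun i j => by
    have e1 : η (m' i) (m' j) = η (m i) (m' j) +
        ∑ k, (-(1 / 2) * η (m i) (m k)) * η (l (b k)) (m' j) := by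
      simp [m']
    rw [e1]
    simp only [h1]
    simp only [m', map_add, map_sum, map_smul, hm']
    simp
    rw [hskew (m j) (m i)]; ring
  have h3 : ∀ i j, η (m' i) (l (b j)) = if j = i then -1 else 0 := fun i j => by
    rw [hskew, h1]; split_ifs <;> simp
  let T : Cn n →ₗ[ℝ] E :=
    { toFun := fun v => ∑ j, ((v j).re • l (b j) + (v j).im • m' j)
      map_add' := fun v w => by
        rw [← Finset.sum_add_distrib]
        refine Finset.sum_congr rfl fun j _ => ?_
        simp only [PiLp.add_apply, Complex.add_re, Complex.add_im, add_smul]; abel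
      map_smul' := fun c v => by
        rw [Finset.smul_sum]
        refine Finset.sum_congr rfl fun j _ => ?_
        simp [mul_smul] }
  have hT : ∀ v w, η (T v) (T w) = stdSymp v w := fun v w => by
    rw [stdSymp_eq_sum]
    have e1 : ∀ u, η u (T w) = ∑ j, ((w j).re * η u (l (b j)) + (w j).im * η u (m' j)) :=
      fun u => by simp [T]
    have e2 : ∀ u, η (T v) u = ∑ j, ((v j).re * η (l (b j)) u + (v j).im * η (m' j) u) :=
      fun u => by simp [T]
    rw [e2]
    refine Finset.sum_congr rfl fun j _ => ?_
    rw [e1, e1]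
    simp [hiso, h1, h2, h3]
    ring
  have hTinj : Function.Injective T := by
    rw [injective_iff_map_eq_zero]
    intro v hv
    -- Nondegeneracy on `ℂⁿ` in the form `σ (v, i v) = ‖v‖²`.
    have : stdSymp v (Complex.I • v) = 0 := by rw [← hT, hv]; simp
    rw [stdSymp, inner_smul_right, inner_self_eq_norm_sq_to_K] at this
    have h4 : ‖v‖ ^ 2 = 0 := by
      simpa [← Complex.ofReal_pow] using this
    simpa using h4
  exact ⟨LinearEquiv.ofInjectiveOfFinrankEq T hTinj ((finrank_Cn n).trans hE.symm), hT⟩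

/-- A Lagrangian subspace of `ℂⁿ` is the real span of a unitary basis. -/
theorem exists_unitary_basis {n : ℕ} {L : Submodule ℝ (Cn n)} (hL : IsLagrangian L) :
    ∃ b : OrthonormalBasis (Fin n) ℂ (Cn n), turnedPlane b 0 = L := by
  let b₀ : OrthonormalBasis (Fin n) ℝ L := (stdOrthonormalBasis ℝ L).reindex (finCongr hL.1)
  have hre : ∀ v w : Cn n, (inner ℂ v w : ℂ).re = inner ℝ v w := fun v w => by
    simp only [PiLp.inner_apply, Complex.re_sum]
    rfl
  -- The Hermitian product has the Euclidean one as real part and `σ` as imaginary part, which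
  -- vanishes on `L`; real orthonormality is thus unitary.
  have ho : Orthonormal ℂ fun j => (b₀ j : Cn n) := by
    rw [orthonormal_iff_ite]
    intro i j
    have h := orthonormal_iff_ite.1 b₀.orthonormal i j
    apply Complex.ext
    · rw [hre]
      change inner ℝ (b₀ i) (b₀ j) = _
      rw [h]; split_ifs <;> simp
    · have : (inner ℂ (b₀ i : Cn n) (b₀ j : Cn n) : ℂ).im = 0 :=
        hL.2 _ (b₀ i).2 _ (b₀ j).2
      rw [this]; split_ifs <;> simp
  have hspan := ho.linearIndependent.span_eq_top_of_card_eq_finrank' (by simp)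
  refine ⟨OrthonormalBasis.mk ho hspan.ge, ?_⟩
  have h1 : turnedPlane (OrthonormalBasis.mk ho hspan.ge) 0 =
      Submodule.span ℝ (Set.range fun j => (b₀ j : Cn n)) := by
    simp [turnedPlane]
  rw [h1]
  have h2 := congrArg (Submodule.map L.subtype) b₀.toBasis.span_eq
  rw [Submodule.map_span, ← Set.range_comp, Submodule.map_subtype_top] at h2
  simpa [Function.comp_def] using h2

/-- The topology of `Λ(n)` is induced by orthogonal projections, so local parametrizations by
injective maps suffice. -/
theorem continuous_lagrangian {Y F : Type*} [TopologicalSpace Y] [NormedAddCommGroup F]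
    [NormedSpace ℝ F] [FiniteDimensional ℝ F] {n : ℕ} {Λ : Y → LagrangianGrassmannian n}
    (h : ∀ y₀, ∃ D : Y → F →L[ℝ] Cn n, ContinuousAt D y₀ ∧ Function.Injective (D y₀) ∧
      ∀ᶠ y in 𝓝 y₀, (Λ y).1 = LinearMap.range (D y).toLinearMap) : Continuous Λ := by
  rw [continuous_induced_rng, continuous_iff_continuousAt]
  intro y₀
  obtain ⟨D, hD, hinj, hev⟩ := h y₀
  exact continuousAt_starProjection hD hinj hev

theorem isLagrangian_range {F : Type*} [AddCommGroup F] [Module ℝ F] {n : ℕ}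
    (hF : Module.finrank ℝ F = n) {D : F →ₗ[ℝ] Cn n} (hinj : Function.Injective D)
    (hiso : ∀ a b, stdSymp (D a) (D b) = 0) : IsLagrangian (LinearMap.range D) := by
  refine ⟨(LinearMap.finrank_range_of_inj hinj).trans hF, ?_⟩
  rintro _ ⟨a, rfl⟩ _ ⟨b, rfl⟩
  exact hiso a b

end Forms

/-! ### Continuous families of linear maps into tangent spaces. -/

section Frames

variable {E : Type*} [NormedAddCommGroup E] [NormedSpace ℝ E]
  {V : Type*} [TopologicalSpace V] [ChartedSpace E V] [IsManifold 𝓘(ℝ, E) 1 V]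
  {Y M : Type*} [TopologicalSpace Y] [NormedAddCommGroup M] [NormedSpace ℝ M]

variable (E) in
/-- The coordinate expression of tangent vectors at `p` in the preferred chart at `c`. -/
def tcoord (c p : V) : E →L[ℝ] E :=
  (trivializationAt E (TangentSpace 𝓘(ℝ, E)) c).continuousLinearMapAt ℝ p

theorem tcoord_apply {c p : V} (hp : p ∈ (chartAt E c).source) (v : E) :
    tcoord E c p v = (trivializationAt E (TangentSpace 𝓘(ℝ, E)) c
      (⟨p, v⟩ : TangentBundle 𝓘(ℝ, E) V)).2 := by
  have hp' : p ∈ (trivializationAt E (TangentSpace 𝓘(ℝ, E)) c).baseSet := by simpa using hp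
  exact ((trivializationAt E (TangentSpace 𝓘(ℝ, E)) c).linearMapAt_apply (R := ℝ)
    (show TangentSpace 𝓘(ℝ, E) p from v)).trans (if_pos hp')

theorem isInvertible_tcoord {c p : V} (hp : p ∈ (chartAt E c).source) :
    (tcoord E c p).IsInvertible := by
  have hp' : p ∈ (trivializationAt E (TangentSpace 𝓘(ℝ, E)) c).baseSet := by simpa using hp
  exact ⟨(trivializationAt E (TangentSpace 𝓘(ℝ, E)) c).continuousLinearEquivAt ℝ p hp',
    DFunLike.coe_injective (Bundle.Trivialization.coe_continuousLinearEquivAt_eq _ hp')⟩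

theorem tcoord_eq_mfderiv {c p : V} (hp : p ∈ (chartAt E c).source) :
    tcoord E c p = (mfderiv 𝓘(ℝ, E) 𝓘(ℝ, E) (extChartAt 𝓘(ℝ, E) c) p : E →L[ℝ] E) :=
  TangentBundle.continuousLinearMapAt_trivializationAt hp

omit [NormedSpace ℝ E] [IsManifold 𝓘(ℝ, E) 1 V] in
theorem eventually_mem_chart {K : Y → V} {y₀ : Y} (hK : ContinuousAt K y₀) :
    ∀ᶠ y in 𝓝 y₀, K y ∈ (chartAt E (K y₀)).source :=
  hK.eventually ((chartAt E (K y₀)).open_source.mem_nhds (mem_chart_source E (K y₀)))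

/-- Reduces continuity into the tangent bundle to continuity in the single chart at `K y₀`. -/
theorem continuousAt_tangentBundle_mk_iff {K : Y → V} {f : Y → E} {y₀ : Y} :
    ContinuousAt (fun y => (⟨K y, f y⟩ : TangentBundle 𝓘(ℝ, E) V)) y₀ ↔
      ContinuousAt K y₀ ∧ ContinuousAt (fun y => tcoord E (K y₀) (K y) (f y)) y₀ := by
  rw [FiberBundle.continuousAt_totalSpace]
  refine and_congr_right fun hK => ?_
  refine continuousAt_congr ?_
  filter_upwards [eventually_mem_chart (E := E) hK] with y hy
  exact (tcoord_apply hy (f y)).symm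

/-- A family of linear maps `f y : M → T_{K y} V` along `K : Y → V` is continuous at a point. -/
def ContinuousFamilyAt (K : Y → V) (f : Y → M →L[ℝ] E) (y₀ : Y) : Prop :=
  ContinuousAt K y₀ ∧ ContinuousAt (fun y => tcoord E (K y₀) (K y) ∘L f y) y₀

theorem continuousFamilyAt_iff [FiniteDimensional ℝ M] [Nonempty M] {K : Y → V}
    {f : Y → M →L[ℝ] E} {y₀ : Y} :
    ContinuousFamilyAt K f y₀ ↔
      ∀ v, ContinuousAt (fun y => (⟨K y, f y v⟩ : TangentBundle 𝓘(ℝ, E) V)) y₀ := by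
  simp only [continuousAt_tangentBundle_mk_iff, ContinuousFamilyAt, continuousAt_clm_apply,
    forall_and, forall_const]
  rfl

theorem continuous_mk_of_continuousFamilyAt {K : Y → V} {f : Y → M →L[ℝ] E}
    (h : ∀ y, ContinuousFamilyAt K f y) :
    Continuous fun q : Y × M => (⟨K q.1, f q.1 q.2⟩ : TangentBundle 𝓘(ℝ, E) V) := by
  rw [continuous_iff_continuousAt]
  intro q
  rw [continuousAt_tangentBundle_mk_iff]
  refine ⟨(h q.1).1.comp (f := Prod.fst) continuousAt_fst, ?_⟩
  have := (h q.1).2.comp (f := Prod.fst) (x := q) continuousAt_fst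
  exact this.clm_apply continuousAt_snd

theorem continuousFamilyAt_of_continuous_mk [FiniteDimensional ℝ M] {K : Y → V}
    {f : Y → M →L[ℝ] E}
    (h : Continuous fun q : Y × M => (⟨K q.1, f q.1 q.2⟩ : TangentBundle 𝓘(ℝ, E) V)) (y : Y) :
    ContinuousFamilyAt K f y := by
  rw [continuousFamilyAt_iff]
  intro v
  exact (h.comp (Continuous.prodMk_left v)).continuousAt

theorem ContinuousFamilyAt.comp {M' : Type*} [NormedAddCommGroup M'] [NormedSpace ℝ M']
    {K : Y → V} {f : Y → M →L[ℝ] E} {y₀ : Y} (h : ContinuousFamilyAt K f y₀)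
    {A : Y → M' →L[ℝ] M} (hA : ContinuousAt A y₀) :
    ContinuousFamilyAt K (fun y => f y ∘L A y) y₀ :=
  ⟨h.1, h.2.clm_comp hA⟩

theorem ContinuousFamilyAt.comp_map {Y' : Type*} [TopologicalSpace Y'] {K : Y → V}
    {f : Y → M →L[ℝ] E} {g : Y' → Y} {y₀ : Y'} (h : ContinuousFamilyAt K f (g y₀))
    (hg : ContinuousAt g y₀) :
    ContinuousFamilyAt (fun y => K (g y)) (fun y => f (g y)) y₀ :=
  ⟨h.1.comp hg, h.2.comp (f := g) hg⟩

/-- Two continuous families over the same map, one of them consisting of isomorphisms, differ by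
a continuous family of linear maps. -/
theorem ContinuousFamilyAt.symm_comp [CompleteSpace E] {M' : Type*} [NormedAddCommGroup M']
    [NormedSpace ℝ M'] [CompleteSpace M'] {K : Y → V} {f : Y → M →L[ℝ] E} {g : Y → M' ≃L[ℝ] E}
    {y₀ : Y} (hf : ContinuousFamilyAt K f y₀)
    (hg : ContinuousFamilyAt K (fun y => (g y : M' →L[ℝ] E)) y₀) :
    ContinuousAt (fun y => ((g y).symm : E →L[ℝ] M') ∘L f y) y₀ := by
  have hi : ∀ y, K y ∈ (chartAt E (K y₀)).source →
      (tcoord E (K y₀) (K y) ∘L (g y : M' →L[ℝ] E)).IsInvertible := fun y hy => by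
    obtain ⟨e, he⟩ := isInvertible_tcoord hy
    exact ⟨(g y).trans e, by rw [← he]; rfl⟩
  refine ((continuousAt_clm_inverse hg.2 (hi y₀ (mem_chart_source E _))).clm_comp hf.2).congr ?_
  filter_upwards [eventually_mem_chart (E := E) hf.1] with y hy
  obtain ⟨e, he⟩ := isInvertible_tcoord hy
  rw [← he]
  have : (e : E →L[ℝ] E) ∘L (g y : M' →L[ℝ] E) = (((g y).trans e : M' ≃L[ℝ] E) : M' →L[ℝ] E) :=
    rfl
  rw [this, ContinuousLinearMap.inverse_equiv]
  ext v; simp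

/-- Near a point, the inverse of the coordinates is a continuous frame. -/
theorem exists_local_frame [CompleteSpace E] {K : Y → V} {y₀ : Y} (hK : ContinuousAt K y₀) :
    ∃ s : Y → E →L[ℝ] E, ContinuousFamilyAt K s y₀ ∧ (∀ᶠ y in 𝓝 y₀, (s y).IsInvertible) ∧
      (s y₀).IsInvertible := by
  have hi : ∀ y, K y ∈ (chartAt E (K y₀)).source →
      (tcoord E (K y₀) (K y)).inverse.IsInvertible := fun y hy => by
    obtain ⟨e, he⟩ := isInvertible_tcoord hy
    exact ⟨e.symm, by rw [← he, ContinuousLinearMap.inverse_equiv]⟩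
  refine ⟨fun y => (tcoord E (K y₀) (K y)).inverse, ⟨hK, ?_⟩, ?_, hi y₀ (mem_chart_source E _)⟩
  · refine (continuousAt_const (y := ContinuousLinearMap.id ℝ E)).congr ?_
    filter_upwards [eventually_mem_chart (E := E) hK] with y hy
    exact (isInvertible_tcoord hy).self_comp_inverse.symm
  · filter_upwards [eventually_mem_chart (E := E) hK] with y hy
    exact hi y hy

variable (E) in
/-- The differential of a map between manifolds, as a linear map between the model spaces. -/
def differential (E' : Type*) [NormedAddCommGroup E'] [NormedSpace ℝ E'] {V' : Type*}
    [TopologicalSpace V'] [ChartedSpace E' V'] (e : V → V') (p : V) : E →L[ℝ] E' :=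
  mfderiv 𝓘(ℝ, E) 𝓘(ℝ, E') e p

theorem ContinuousFamilyAt.mfderiv_comp [FiniteDimensional ℝ M] {E' V' : Type*}
    [NormedAddCommGroup E'] [NormedSpace ℝ E'] [TopologicalSpace V'] [ChartedSpace E' V']
    [IsManifold 𝓘(ℝ, E') 1 V'] {e : V → V'} (he : ContMDiff 𝓘(ℝ, E) 𝓘(ℝ, E') 1 e)
    {K : Y → V} {f : Y → M →L[ℝ] E} {y₀ : Y} (hf : ContinuousFamilyAt K f y₀) :
    ContinuousFamilyAt (fun y => e (K y))
      (fun y => differential E E' e (K y) ∘L f y) y₀ := by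
  rw [continuousFamilyAt_iff] at hf ⊢
  intro v
  exact (he.continuous_tangentMap le_rfl).continuousAt.comp (hf v)

theorem tcoord_model_space (c p : E) : tcoord E c p = ContinuousLinearMap.id ℝ E := by
  have hp : p ∈ (chartAt E c).source := by rw [chartAt_self_eq]; trivial
  have : (extChartAt 𝓘(ℝ, E) c : E → E) = id := by
    simp only [extChartAt, chartAt_self_eq]; rfl
  rw [tcoord_eq_mfderiv hp, this]
  exact mfderiv_id

theorem ContinuousFamilyAt.continuousAt {K : Y → E} {f : Y → M →L[ℝ] E} {y₀ : Y}
    (hf : ContinuousFamilyAt K f y₀) : ContinuousAt f y₀ := by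
  have := hf.2
  simpa only [tcoord_model_space, ContinuousLinearMap.id_comp] using this

end Frames

/-! ### Triviality of pulled-back tangent bundles. -/

section Bundles

variable {E : Type*} [NormedAddCommGroup E] [NormedSpace ℝ E] [FiniteDimensional ℝ E]
  {V : Type*} [TopologicalSpace V] [ChartedSpace E V] [IsManifold 𝓘(ℝ, E) ∞ V]

/-- A manifold has a smooth map to a Euclidean space that is an immersion along a given compact
set. -/
theorem exists_immersion_on_compact [T2Space V] [SigmaCompactSpace V] {s : Set V}
    (hs : IsCompact s) :
    ∃ (N : ℕ) (e : V → EuclideanSpace ℝ (Fin N)),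
      ContMDiff 𝓘(ℝ, E) 𝓘(ℝ, EuclideanSpace ℝ (Fin N)) ∞ e ∧
      ∀ x ∈ s, Function.Injective (mfderiv 𝓘(ℝ, E) 𝓘(ℝ, EuclideanSpace ℝ (Fin N)) e x) := by
  obtain ⟨ι, f, -⟩ := SmoothBumpCovering.exists_isSubordinate 𝓘(ℝ, E) hs.isClosed
    (U := fun _ => Set.univ) fun _ _ => univ_mem
  have hfin : Finite ι := by
    have h := f.locallyFinite.finite_nonempty_inter_compact hs
    refine Set.finite_univ_iff.1 (h.subset fun i _ => ?_)
    exact ⟨f.c i, (f i).c_mem_support, f.c_mem' i⟩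
  have := Fintype.ofFinite ι
  let eE : (ι → E) ≃L[ℝ] EuclideanSpace ℝ (Fin (Module.finrank ℝ (ι → E))) := toEuclidean
  let e₀ : V → ι → E := fun x i => f i x • extChartAt 𝓘(ℝ, E) (f.c i) x
  have he₀ : ContMDiff 𝓘(ℝ, E) 𝓘(ℝ, ι → E) ∞ e₀ :=
    contMDiff_pi_space.2 fun i => (f i).contMDiff_smul contMDiffOn_extChartAt
  have he : ContMDiff 𝓘(ℝ, E) 𝓘(ℝ, EuclideanSpace ℝ (Fin (Module.finrank ℝ (ι → E)))) ∞
      (eE ∘ e₀) := eE.contDiff.contMDiff.comp he₀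
  refine ⟨_, eE ∘ e₀, he, fun x hx => ?_⟩
  -- The bump function of index `i` is `1` near `x`, so component `i` of `e₀` is a chart there and
  -- its differential is already injective.
  let i := f.ind x hx
  let A : EuclideanSpace ℝ (Fin (Module.finrank ℝ (ι → E))) →L[ℝ] E :=
    (ContinuousLinearMap.proj i) ∘L (eE.symm : _ →L[ℝ] (ι → E))
  have hA : HasMFDerivAt 𝓘(ℝ, E) 𝓘(ℝ, E) (A ∘ (eE ∘ e₀)) x
      (A ∘L (mfderiv 𝓘(ℝ, E) 𝓘(ℝ, EuclideanSpace ℝ (Fin (Module.finrank ℝ (ι → E))))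
        (eE ∘ e₀) x)) :=
    A.hasMFDerivAt.comp x (he.mdifferentiableAt (by simp)).hasMFDerivAt
  have hev : A ∘ (eE ∘ e₀) =ᶠ[𝓝 x] extChartAt 𝓘(ℝ, E) (f.c i) := by
    filter_upwards [f.eventuallyEq_one x hx] with y hy
    have hy : f i y = 1 := hy
    simp [A, e₀, hy]
  have hchart := f.mem_chartAt_ind_source x hx
  obtain ⟨g, hg⟩ := isInvertible_tcoord (E := E) hchart
  rw [tcoord_eq_mfderiv hchart, ← (hev.mfderiv_eq (I := 𝓘(ℝ, E)) (I' := 𝓘(ℝ, E))), hA.mfderiv]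
    at hg
  refine Function.Injective.of_comp (f := A) ?_
  intro v w hvw
  apply g.injective
  have h1 : ∀ v, g v = A (mfderiv 𝓘(ℝ, E)
      𝓘(ℝ, EuclideanSpace ℝ (Fin (Module.finrank ℝ (ι → E)))) (eE ∘ e₀) x v) :=
    fun v => DFunLike.congr_fun hg v
  exact (h1 v).trans (hvw.trans (h1 w).symm)

-- The form in the chart at `K y₀` is continuous and is evaluated on the chart coordinates of the
-- vectors; the differentials of the chart and of its inverse cancel.
omit [FiniteDimensional ℝ E] in
theorem continuousAt_form {Ω : ∀ x : V, TangentSpace 𝓘(ℝ, E) x [⋀^Fin 2]→L[ℝ] ℝ}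
    (hΩ : IsSymplecticForm Ω) {Y : Type*} [TopologicalSpace Y] {K : Y → V} {a b : Y → E} {y₀ : Y}
    (ha : ContinuousAt (fun y => (⟨K y, a y⟩ : TangentBundle 𝓘(ℝ, E) V)) y₀)
    (hb : ContinuousAt (fun y => (⟨K y, b y⟩ : TangentBundle 𝓘(ℝ, E) V)) y₀) :
    ContinuousAt (fun y => Ω (K y) ![a y, b y]) y₀ := by
  rw [continuousAt_tangentBundle_mk_iff] at ha hb
  have hK := ha.1
  let φ := extChartAt 𝓘(ℝ, E) (K y₀)
  have h1 : ContinuousAt (fun y => formInChart Ω (K y₀) (φ (K y))) y₀ := by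
    have h2 : ContinuousAt (formInChart Ω (K y₀)) (φ (K y₀)) :=
      (hΩ.smooth (K y₀)).continuousOn.continuousAt (extChartAt_target_mem_nhds (K y₀))
    exact h2.comp (f := fun y => φ (K y)) ((continuousAt_extChartAt (K y₀)).comp hK)
  have h3 : ContinuousAt (fun y => formInChart Ω (K y₀) (φ (K y))
      ![tcoord E (K y₀) (K y) (a y), tcoord E (K y₀) (K y) (b y)]) y₀ := by
    have h4 : ContinuousAt (fun y =>
        ![tcoord E (K y₀) (K y) (a y), tcoord E (K y₀) (K y) (b y)]) y₀ := by
      rw [continuousAt_pi]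
      intro i
      fin_cases i
      · exact ha.2
      · exact hb.2
    exact h1.eval h4
  refine h3.congr ?_
  filter_upwards [eventually_mem_chart (E := E) hK] with y hy
  have hy' : K y ∈ (extChartAt 𝓘(ℝ, E) (K y₀)).source := by rwa [extChartAt_source]
  have h5 := mfderivWithin_extChartAt_symm_comp_mfderiv_extChartAt' (I := 𝓘(ℝ, E)) hy'
  simp only [modelWithCornersSelf_coe, Set.range_id, mfderivWithin_univ] at h5
  have h6 : ∀ v : E, (mfderiv 𝓘(ℝ, E) 𝓘(ℝ, E) φ.symm (φ (K y)) : E →L[ℝ] E)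
      (tcoord E (K y₀) (K y) v) = v := fun v => by
    rw [tcoord_eq_mfderiv hy]
    exact DFunLike.congr_fun h5 v
  have h7 : ∀ p, p = K y → ∀ v : Fin 2 → E, Ω p v = Ω (K y) v := by
    rintro _ rfl _; rfl
  refine (h7 _ (φ.left_inv hy') _).trans ?_
  congr 1
  funext i
  fin_cases i
  · exact h6 _
  · exact h6 _

omit [FiniteDimensional ℝ E] in
theorem ContinuousFamilyAt.congr {Y M : Type*} [TopologicalSpace Y] [NormedAddCommGroup M]
    [NormedSpace ℝ M] {K : Y → V} {f g : Y → M →L[ℝ] E} {y₀ : Y} (h : ContinuousFamilyAt K f y₀)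
    (hfg : f =ᶠ[𝓝 y₀] g) : ContinuousFamilyAt K g y₀ := by
  refine ⟨h.1, h.2.congr ?_⟩
  filter_upwards [hfg] with y hy
  rw [hy]

theorem exists_equiv_of_range_le {G : Type*} [NormedAddCommGroup G] [NormedSpace ℝ G]
    {j η : E →L[ℝ] G} (hj : Function.Injective j) (hη : Function.Injective η)
    (h : ∀ v, ∃ w, j w = η v) : ∃ ψ : E ≃L[ℝ] E, ∀ v, j (ψ v) = η v := by
  obtain ⟨Q, hQ⟩ := j.toLinearMap.exists_leftInverse_of_injective (LinearMap.ker_eq_bot.2 hj)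
  have hQ' : ∀ v, Q (j v) = v := fun v => DFunLike.congr_fun hQ v
  have h1 : ∀ v, j (Q (η v)) = η v := fun v => by
    obtain ⟨w, hw⟩ := h v
    rw [← hw, hQ']
  have hi : Function.Injective (Q ∘ₗ η.toLinearMap) := fun v w hvw => hη (by
    rw [← h1 v, ← h1 w]; exact congrArg j hvw)
  exact ⟨(LinearEquiv.ofInjectiveEndo _ hi).toContinuousLinearEquiv, fun v => h1 v⟩

/-- The pull-back of the tangent bundle to a compact contractible space is trivial. -/
theorem exists_global_frame [T2Space V] [SigmaCompactSpace V] {X : Type*} [TopologicalSpace X]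
    [CompactSpace X] {H : X → V} (hH : Continuous H) {h : unitInterval × X → X}
    (hh : Continuous h) {x₀ : X} (h0 : ∀ x, h (0, x) = x₀) (h1 : ∀ x, h (1, x) = x) :
    ∃ ψ : X → E ≃L[ℝ] E, ∀ x, ContinuousFamilyAt H (fun x => (ψ x : E →L[ℝ] E)) x := by
  obtain ⟨N, e, he, hinj⟩ := exists_immersion_on_compact (E := E) (isCompact_range hH)
  let j : V → E →L[ℝ] EuclideanSpace ℝ (Fin N) := differential E (EuclideanSpace ℝ (Fin N)) e
  have hj : ∀ x, Function.Injective (j (H x)) := fun x => hinj _ ⟨x, rfl⟩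
  have hjs : ∀ {Y : Type _} [TopologicalSpace Y] {K : Y → V} {s : Y → E →L[ℝ] E} {y : Y},
      ContinuousFamilyAt K s y → ContinuousAt (fun y => j (K y) ∘L s y) y := fun hs =>
    (hs.mfderiv_comp (he.of_le (by simp))).continuousAt
  -- `P (t, x)` projects onto the image of the tangent space at `H (h (t, x))`: a fixed subspace at
  -- `t = 0`, the fibre over `x` at `t = 1`. Conjugation by `τ` carries the former to the latter.
  let P : unitInterval × X → EuclideanSpace ℝ (Fin N) →L[ℝ] EuclideanSpace ℝ (Fin N) := fun q =>
    (LinearMap.range (j (H (h q))).toLinearMap).starProjection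
  have hP : Continuous P := by
    rw [continuous_iff_continuousAt]
    intro q
    obtain ⟨s, hs, hs', hs0⟩ := exists_local_frame (E := E) (hH.comp hh).continuousAt (y₀ := q)
    refine continuousAt_starProjection (hjs hs) ((hj _).comp hs0.injective) ?_
    filter_upwards [hs'] with y hy
    refine (LinearMap.range_comp_of_range_eq_top _ ?_).symm
    exact LinearMap.range_eq_top.2 hy.surjective
  obtain ⟨τ, hτ, hτP⟩ := exists_conj_idempotents hP
    fun q => (Submodule.isIdempotentElem_starProjection _).eq
  let η : X → E →L[ℝ] EuclideanSpace ℝ (Fin N) := fun x =>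
    (τ x : EuclideanSpace ℝ (Fin N) →L[ℝ] EuclideanSpace ℝ (Fin N)) ∘L j (H x₀)
  have hη : Continuous η := (Units.continuous_val.comp hτ).clm_comp continuous_const
  have hηinj : ∀ x, Function.Injective (η x) := fun x => by
    have hτi : Function.LeftInverse
        (↑(τ x)⁻¹ : EuclideanSpace ℝ (Fin N) →L[ℝ] EuclideanSpace ℝ (Fin N))
        (τ x : EuclideanSpace ℝ (Fin N) →L[ℝ] EuclideanSpace ℝ (Fin N)) := fun v =>
      DFunLike.congr_fun (τ x).inv_mul v
    have hj₀ : Function.Injective (j (H x₀)) := hj x₀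
    exact hτi.injective.comp hj₀
  have hψ : ∀ x, ∃ ψ : E ≃L[ℝ] E, ∀ v, j (H x) (ψ v) = η x v := fun x => by
    refine exists_equiv_of_range_le (hj x) (hηinj x) fun v => ?_
    have e1 : P (0, x) (j (H x₀) v) = j (H x₀) v := by
      rw [Submodule.starProjection_eq_self_iff, h0]
      exact ⟨v, rfl⟩
    have e2 : η x v = P (1, x) ((τ x : EuclideanSpace ℝ (Fin N) →L[ℝ] _) (j (H x₀) v)) := by
      have := DFunLike.congr_fun (hτP x) (j (H x₀) v)
      rw [mul_apply_eq_comp, e1] at this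
      exact this
    have e3 : η x v ∈ LinearMap.range (j (H (h (1, x)))).toLinearMap := by
      rw [e2]; exact Submodule.starProjection_apply_mem _ _
    rw [h1] at e3
    exact e3
  choose ψ hψ using hψ
  refine ⟨ψ, fun x => ?_⟩
  obtain ⟨s, hs, hs', hs0⟩ := exists_local_frame (E := E) hH.continuousAt (y₀ := x)
  -- In the local frame `s`, `ψ` equals `s ∘ Q ∘ η`, a composite of continuous families.
  obtain ⟨Q, hQ, hQD⟩ := exists_left_inverse_family (hjs hs) ((hj _).comp hs0.injective)
  refine (hs.comp (hQ.clm_comp hη.continuousAt)).congr ?_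
  filter_upwards [hs', hQD] with y hy hyD
  ext v
  obtain ⟨w, hw⟩ := hy.surjective (ψ y v)
  have e1 : Q y (j (H y) (s y w)) = w := DFunLike.congr_fun hyD.1 w
  rw [hw, hψ] at e1
  change s y (Q y (η y v)) = ψ y v
  rw [e1, hw]

theorem exists_bilinear_of_alternating (a : E [⋀^Fin 2]→L[ℝ] ℝ) :
    ∃ B : E →L[ℝ] E →L[ℝ] ℝ, ∀ v w, B v w = a ![v, w] := by
  have hu : ∀ v w : E, Function.update ![v, 0] 1 w = ![v, w] := fun v w => by
    ext i; fin_cases i <;> rfl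
  let b : E →ₗ[ℝ] E →ₗ[ℝ] ℝ := LinearMap.mk₂ ℝ (fun v w => a ![v, w])
    (fun v v' w => a.vecCons_add _ _ _) (fun c v w => a.vecCons_smul _ _ _)
    (fun v w w' => by
      have := a.map_update_add ![v, 0] 1 w w'
      rwa [hu, hu, hu] at this)
    (fun c v w => by
      have := a.map_update_smul ![v, 0] 1 c w
      rwa [hu, hu] at this)
  exact ⟨LinearMap.toContinuousLinearMap (LinearMap.toContinuousLinearMap.toLinearMap ∘ₗ b),
    fun v w => rfl⟩

/-- A symplectic vector bundle that is pulled back from the tangent bundle to a compact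
contractible space is symplectically trivial, if one of its fibres has a Lagrangian subspace. -/
theorem exists_symplectic_frame [T2Space V] [SigmaCompactSpace V] {n : ℕ}
    (hn : Module.finrank ℝ E = 2 * n)
    {Ω : ∀ x : V, TangentSpace 𝓘(ℝ, E) x [⋀^Fin 2]→L[ℝ] ℝ} (hΩ : IsSymplecticForm Ω)
    {X : Type*} [TopologicalSpace X]
    [CompactSpace X] {H : X → V} (hH : Continuous H) {h : unitInterval × X → X}
    (hh : Continuous h) {x₀ : X} (h0 : ∀ x, h (0, x) = x₀) (h1 : ∀ x, h (1, x) = x)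
    {F : Type*} [AddCommGroup F] [Module ℝ F] [FiniteDimensional ℝ F]
    (hF : Module.finrank ℝ F = n) (l : F →ₗ[ℝ] E) (hl : Function.Injective l)
    (hiso : ∀ a b, Ω (H x₀) ![l a, l b] = 0) :
    ∃ ψ : X → Cn n ≃L[ℝ] E, (∀ x, ContinuousFamilyAt H (fun x => (ψ x : Cn n →L[ℝ] E)) x) ∧
      ∀ x v w, Ω (H x) ![ψ x v, ψ x w] = stdSymp v w := by
  obtain ⟨ψ, hψ⟩ := exists_global_frame (E := E) hH hh h0 h1
  obtain ⟨B, hB⟩ : ∃ B : V → E →L[ℝ] E →L[ℝ] ℝ, ∀ p (v w : E), B p v w = Ω p ![v, w] :=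
    ⟨_, fun p => (exists_bilinear_of_alternating (show E [⋀^Fin 2]→L[ℝ] ℝ from Ω p)).choose_spec⟩
  let η : X → E →L[ℝ] E →L[ℝ] ℝ := fun x =>
    (B (H x)).bilinearComp (ψ x : E →L[ℝ] E) (ψ x : E →L[ℝ] E)
  have hη : ∀ x v w, η x v w = B (H x) (ψ x v) (ψ x w) := fun x v w => rfl
  have hηc : Continuous η := by
    rw [continuous_iff_continuousAt]
    intro x
    rw [continuousAt_clm_apply]
    intro v
    rw [continuousAt_clm_apply]
    intro w
    simp only [hη, hB]
    exact continuousAt_form hΩ (continuousFamilyAt_iff.1 (hψ x) v)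
      (continuousFamilyAt_iff.1 (hψ x) w)
  have halt : ∀ x v, η x v v = 0 := fun x v => by
    rw [hη, hB]
    exact (Ω (H x)).map_eq_zero_of_eq _ (i := 0) (j := 1) rfl (by simp)
  have hnd : ∀ x v, (∀ w, η x v w = 0) → v = 0 := fun x v hv => by
    have : ψ x v = 0 := hΩ.nondegenerate (H x) (ψ x v) fun (w : E) => by
      have h2 := hv ((ψ x).symm w)
      rw [hη, ContinuousLinearEquiv.apply_symm_apply] at h2
      exact (hB _ _ _).symm.trans h2
    simpa using this
  -- Along the contraction `h` the form `η` is deformed to its value at `x₀`, which does not depend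
  -- on `x`.
  obtain ⟨τ, hτ, hτη⟩ := exists_equiv_forms (hηc.comp hh) (fun q => halt _) (fun q => hnd _)
  obtain ⟨T, hT⟩ := exists_symplectic_equiv hn hF (halt x₀) (hnd x₀)
    (((ψ x₀).symm : E →L[ℝ] E).toLinearMap ∘ₗ l) ((ψ x₀).symm.injective.comp hl) fun a b => by
      rw [hη]
      simp only [LinearMap.comp_apply, ContinuousLinearMap.coe_coe, ContinuousLinearEquiv.coe_coe,
        ContinuousLinearEquiv.apply_symm_apply]
      exact (hB _ _ _).trans (hiso a b)
  refine ⟨fun x => (T.toContinuousLinearEquiv.trans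
    (ContinuousLinearEquiv.unitsEquiv ℝ E (τ x)⁻¹)).trans (ψ x), fun x => ?_, fun x v w => ?_⟩
  · have hA : Continuous fun x => (↑(τ x)⁻¹ : E →L[ℝ] E) ∘L
        (T.toContinuousLinearEquiv : Cn n →L[ℝ] E) :=
      (Units.continuous_val.comp hτ.inv).clm_comp continuous_const
    exact ((hψ x).comp hA.continuousAt).congr (Eventually.of_forall fun y => rfl)
  · have e1 : ∀ v, (τ x : E →L[ℝ] E) ((↑(τ x)⁻¹ : E →L[ℝ] E) v) = v := fun v =>
      DFunLike.congr_fun (τ x).mul_inv v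
    have e2 := hτη x ((↑(τ x)⁻¹ : E →L[ℝ] E) (T v)) ((↑(τ x)⁻¹ : E →L[ℝ] E) (T w))
    rw [e1, e1] at e2
    simp only [Function.comp_apply, h0, h1] at e2
    rw [hT, hη] at e2
    exact (hB _ _ _).symm.trans e2.symm

end Bundles

/-! ### Injectivity of the differential of an immersion. -/

section Immersions

variable {E : Type*} [NormedAddCommGroup E] [NormedSpace ℝ E]
  {V : Type*} [TopologicalSpace V] [ChartedSpace E V] [IsManifold 𝓘(ℝ, E) ∞ V]
  {F : Type*} [NormedAddCommGroup F] [NormedSpace ℝ F]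
  {W : Type*} [TopologicalSpace W] [ChartedSpace F W] [IsManifold 𝓘(ℝ, F) ∞ W]

omit [IsManifold 𝓘(ℝ, E) ∞ V] [IsManifold 𝓘(ℝ, F) ∞ W] in
theorem injective_mfderiv_of_isImmersionAt {f : W → V} {x : W}
    (h : Manifold.IsImmersionAt 𝓘(ℝ, F) 𝓘(ℝ, E) ∞ f x) :
    Function.Injective (mfderiv 𝓘(ℝ, F) 𝓘(ℝ, E) f x) := by
  let c := h.domChart.extend 𝓘(ℝ, F)
  let c' := h.codChart.extend 𝓘(ℝ, E)
  let pr : E →L[ℝ] F := ContinuousLinearMap.fst ℝ F _ ∘L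
    (h.equiv.symm : E →L[ℝ] (F × h.complement))
  -- In adapted charts an immersion is a linear inclusion; projecting back gives a local left
  -- inverse, and the chain rule does the rest.
  let g : V → W := fun p => c.symm (pr (c' p))
  have hsrc : ∀ y ∈ h.domChart.source, pr (c' (f y)) = c y := fun y hy => by
    have h1 : c y ∈ c.target := c.map_source (by rwa [OpenPartialHomeomorph.extend_source])
    have h2 := h.writtenInCharts h1
    simp only [Function.comp_apply] at h2
    have h3 : (h.domChart.extend 𝓘(ℝ, F)).symm (c y) = y :=
      c.left_inv (by rwa [OpenPartialHomeomorph.extend_source])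
    rw [h3] at h2
    change pr ((h.codChart.extend 𝓘(ℝ, E)) (f y)) = c y
    rw [h2]
    simp [pr]
  have hgf : g ∘ f =ᶠ[𝓝 x] id := by
    filter_upwards [h.domChart.open_source.mem_nhds h.mem_domChart_source] with y hy
    simp only [g, Function.comp_apply, id, hsrc y hy]
    exact c.left_inv (by rwa [OpenPartialHomeomorph.extend_source])
  have hc' : MDifferentiableAt 𝓘(ℝ, E) 𝓘(ℝ, E) c' (f x) :=
    (OpenPartialHomeomorph.contMDiffAt_extend h.codChart_mem_maximalAtlas
      h.mem_codChart_source).mdifferentiableAt (by simp)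
  have hcs : MDifferentiableAt 𝓘(ℝ, F) 𝓘(ℝ, F) c.symm (pr (c' (f x))) := by
    rw [hsrc x h.mem_domChart_source]
    have h1 := contMDiffOn_extend_symm (I := 𝓘(ℝ, F)) h.domChart_mem_maximalAtlas
    refine (h1.contMDiffAt ?_).mdifferentiableAt (by simp)
    simp only [modelWithCornersSelf_coe, Set.image_id]
    exact h.domChart.open_target.mem_nhds (h.domChart.map_source h.mem_domChart_source)
  have hg : MDifferentiableAt 𝓘(ℝ, E) 𝓘(ℝ, F) g (f x) :=
    hcs.comp (f x) (pr.mdifferentiableAt.comp (f x) hc')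
  have hf : MDifferentiableAt 𝓘(ℝ, F) 𝓘(ℝ, E) f x := h.contMDiffAt.mdifferentiableAt (by simp)
  have h4 := mfderiv_comp x hg hf
  rw [hgf.mfderiv_eq, mfderiv_id] at h4
  refine Function.LeftInverse.injective (g := mfderiv 𝓘(ℝ, E) 𝓘(ℝ, F) g (f x)) fun v => ?_
  exact (DFunLike.congr_fun h4 v).symm

end Immersions

/-! ### Straight-line contraction of the disk. -/

section Disk

/-- The segment from the point `c` of the disk to the point `z`, parametrised by `[0, 1]`. -/
def diskSegment (c : Disk) (q : unitInterval × Disk) : Disk :=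
  ⟨(1 - q.1 : ℝ) • (c : ℂ) + (q.1 : ℝ) • (q.2 : ℂ),
    (convex_closedBall (0 : ℂ) 1) c.2 q.2.2 (by simpa using q.1.2.2) q.1.2.1 (by ring)⟩

theorem continuous_diskSegment (c : Disk) : Continuous (diskSegment c) := by
  unfold diskSegment
  fun_prop

theorem diskSegment_zero (c z : Disk) : diskSegment c (0, z) = c := by
  simp [diskSegment]

theorem diskSegment_one (c z : Disk) : diskSegment c (1, z) = z := by
  simp [diskSegment]

theorem continuous_bdry : Continuous bdry := by
  unfold bdry
  fun_prop

end Disk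

/-! ### Tangent planes of a Lagrangian submanifold in a trivialization. -/

section Lagrangian

variable {E : Type*} [NormedAddCommGroup E] [NormedSpace ℝ E] [FiniteDimensional ℝ E]
  {V : Type*} [TopologicalSpace V] [ChartedSpace E V] [IsManifold 𝓘(ℝ, E) ∞ V]
  {F : Type*} [NormedAddCommGroup F] [NormedSpace ℝ F] [FiniteDimensional ℝ F]
  {W : Type*} [TopologicalSpace W] [ChartedSpace F W] [IsManifold 𝓘(ℝ, F) ∞ W]

/-- The tangent spaces of a Lagrangian submanifold along a continuous map form a continuous
family of Lagrangian subspaces in a symplectic trivialization. -/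
theorem exists_lagrangian_family {n : ℕ} (hn : Module.finrank ℝ E = 2 * n)
    {Ω : ∀ x : V, TangentSpace 𝓘(ℝ, E) x [⋀^Fin 2]→L[ℝ] ℝ} {ι : W → V}
    (hι : IsClosedLagrangian (F := F) Ω ι) {Y : Type*} [TopologicalSpace Y]
    {K : Y → V} {w : Y → W} (hw : Continuous w) (hK : ∀ y, K y = ι (w y))
    {θ : Y → Cn n ≃L[ℝ] E} (hθ : ∀ y, ContinuousFamilyAt K (fun y => (θ y : Cn n →L[ℝ] E)) y)
    (hsymp : ∀ y v v', Ω (K y) ![θ y v, θ y v'] = stdSymp v v') :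
    ∃ Λ : C(Y, LagrangianGrassmannian n), ∀ y, (Λ y).1 = LinearMap.range
      (((θ y).symm : E →L[ℝ] Cn n) ∘L differential F E ι (w y)).toLinearMap := by
  obtain rfl : K = fun y => ι (w y) := funext hK
  have hF : Module.finrank ℝ F = n := by have := hι.half_dim; omega
  let j : W → F →L[ℝ] E := differential F E ι
  have hj : ∀ p, Function.Injective (j p) := fun p =>
    injective_mfderiv_of_isImmersionAt (hι.embedding.isImmersion.isImmersionAt p)
  have hL : ∀ y, IsLagrangian (LinearMap.range (((θ y).symm : E →L[ℝ] Cn n) ∘L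
      j (w y)).toLinearMap) := fun y => by
    refine isLagrangian_range hF ((θ y).symm.injective.comp (hj (w y))) fun a b => ?_
    rw [← hsymp y]
    refine Eq.trans ?_ (hι.isotropic (w y) a b)
    congr 1
    funext i
    fin_cases i
    · exact (θ y).apply_symm_apply _
    · exact (θ y).apply_symm_apply _
  refine ⟨⟨fun y => ⟨_, hL y⟩, continuous_lagrangian (F := F) fun y₀ => ?_⟩, fun y => rfl⟩
  obtain ⟨s, hs, hs', hs0⟩ := exists_local_frame (E := F) hw.continuousAt (y₀ := y₀)
  have hjs : ContinuousFamilyAt (fun y => ι (w y)) (fun y => j (w y) ∘L s y) y₀ :=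
    -- A local frame of `TW` turns the differential of `ι` into a continuous family without changing
    -- its range.
    hs.mfderiv_comp (hι.embedding.contMDiff.of_le (by simp))
  refine ⟨_, hjs.symm_comp (hθ y₀),
    (θ y₀).symm.injective.comp ((hj _).comp hs0.injective), ?_⟩
  filter_upwards [hs'] with y hy
  refine (LinearMap.range_comp_of_range_eq_top
    (((θ y).symm : E →L[ℝ] Cn n) ∘L j (w y)).toLinearMap ?_).symm
  exact LinearMap.range_eq_top.2 hy.surjective

omit [FiniteDimensional ℝ E] [IsManifold 𝓘(ℝ, E) ∞ V] in
theorem tangentBundle_mk_inj {p p' : V} {v v' : E}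
    (h : (⟨p, v⟩ : TangentBundle 𝓘(ℝ, E) V) = ⟨p', v'⟩) : p = p' ∧ v = v' :=
  ⟨congrArg (fun q : TangentBundle 𝓘(ℝ, E) V => q.1) h,
    congrArg (fun q : TangentBundle 𝓘(ℝ, E) V => (show E from q.2)) h⟩

omit [FiniteDimensional ℝ E] [IsManifold 𝓘(ℝ, E) ∞ V]
  [FiniteDimensional ℝ F] [IsManifold 𝓘(ℝ, F) ∞ W] in
theorem tangentOfRange_eq {ι : W → V} (hι : Function.Injective ι) {p : V} {w : W} (hw : ι w = p) :
    tangentOfRange (E := E) (F := F) ι p = Set.range (differential F E ι w) := by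
  ext v
  constructor
  · rintro ⟨⟨w', a⟩, h⟩
    obtain ⟨h1, h2⟩ := tangentBundle_mk_inj h
    obtain rfl : w' = w := hι (h1.trans hw.symm)
    exact ⟨a, h2⟩
  · rintro ⟨a, rfl⟩
    subst hw
    exact ⟨⟨w, a⟩, rfl⟩

end Lagrangian

end SymplecticDisk

end

/-! ### The Maslov index of the boundary loop. -/

open SymplecticDisk Filter in
theorem lemma2p1 {E : Type*} [NormedAddCommGroup E] [NormedSpace ℝ E] [FiniteDimensional ℝ E]
    {F : Type*} [NormedAddCommGroup F] [NormedSpace ℝ F] [FiniteDimensional ℝ F]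
    {V : Type*} [TopologicalSpace V] [T2Space V] [SecondCountableTopology V]
    [ChartedSpace E V] [IsManifold 𝓘(ℝ, E) ∞ V]
    {W : Type*} [TopologicalSpace W] [ChartedSpace F W] [IsManifold 𝓘(ℝ, F) ∞ W]
    (n : ℕ) (hn : Module.finrank ℝ E = 2 * n)
    (Ω : ∀ x : V, TangentSpace 𝓘(ℝ, E) x [⋀^Fin 2]→L[ℝ] ℝ)
    (hΩ : SymplecticDisk.IsSymplecticForm Ω)
    (ι : W → V) (hι : SymplecticDisk.IsClosedLagrangian (F := F) Ω ι)
    (k : ℕ∞) (hk : 1 ≤ k) (u : ℂ → V)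
    (hu : ContMDiffOn 𝓘(ℝ, ℂ) 𝓘(ℝ, E) k u (Metric.closedBall 0 1))
    (hu_bdry : ∀ z : Circle, u z ∈ Set.range ι)
    (hu_contr : SymplecticDisk.ContractibleRel u (Set.range ι)) :
    Nonempty (SymplecticDisk.SymplecticTrivialization n Ω u) ∧
    ∀ Φ : SymplecticDisk.SymplecticTrivialization n Ω u,
      ∃ Γ : C(Circle, SymplecticDisk.LagrangianGrassmannian n),
        SymplecticDisk.IsBoundaryLoop (F := F) Φ ι Γ ∧ SymplecticDisk.HasMaslovIndex Γ 0 := by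
  have : LocallyCompactSpace V := ChartedSpace.locallyCompactSpace E V
  obtain ⟨H, p, hH0, hH1, hHW⟩ := hu_contr
  have hF : Module.finrank ℝ F = n := by have := hι.half_dim; omega
  have hinj : Function.Injective ι := hι.embedding.isEmbedding.injective
  -- the lift of the boundary values of the homotopy to the Lagrangian submanifold
  choose w hw using fun y : unitInterval × Circle => hHW y.1 y.2
  have hwc : Continuous w := by
    rw [hι.embedding.isEmbedding.continuous_iff]
    exact (H.continuous.comp (continuous_fst.prodMk (continuous_bdry.comp continuous_snd))).congr
      fun y => (hw y).symm
  -- a symplectic trivialization over the homotopy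
  let c : Disk := bdry 1
  let h : unitInterval × (unitInterval × Disk) → unitInterval × Disk := fun q =>
    (q.1 * q.2.1, diskSegment c (q.1, q.2.2))
  have hh : Continuous h :=
    (continuous_fst.mul (continuous_fst.comp continuous_snd)).prodMk
      ((continuous_diskSegment c).comp
        (continuous_fst.prodMk (continuous_snd.comp continuous_snd)))
  obtain ⟨ψ, hψ, hψs⟩ := exists_symplectic_frame (E := E) hn hΩ H.continuous hh (x₀ := (0, c))
    (fun x => by simp [h, diskSegment_zero]) (fun x => by simp [h, diskSegment_one]) hF
    (differential F E ι (w (0, 1))).toLinearMap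
    (injective_mfderiv_of_isImmersionAt (hι.embedding.isImmersion.isImmersionAt _))
    (fun a b => by
      have h1 : ∀ p, p = ι (w (0, 1)) → ∀ v : Fin 2 → E, Ω p v = Ω (ι (w (0, 1))) v := by
        rintro _ rfl _; rfl
      exact (h1 _ (hw (0, 1)).symm _).trans (hι.isotropic (w (0, 1)) a b))
  have hu0 : (fun z : Disk => u z) = fun z => H (0, z) := funext fun z => (hH0 z).symm
  -- `B` is `Ω` on the model space, where base points can be rewritten without dependent types.
  obtain ⟨B, hB⟩ : ∃ B : V → E → E → ℝ, ∀ p (v w : E), B p v w = Ω p ![v, w] :=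
    ⟨_, fun _ _ _ => rfl⟩
  have hψ0 : ∀ z : Disk, ContinuousFamilyAt (fun z : Disk => u z)
      (fun z => (ψ (0, z) : Cn n →L[ℝ] E)) z := fun z => by
    rw [hu0]
    exact (hψ (0, z)).comp_map (g := fun z : Disk => ((0 : unitInterval), z)) (by fun_prop)
  have hψB : ∀ x v w, B (H x) (ψ x v) (ψ x w) = stdSymp v w := fun x v w =>
    (hB _ _ _).trans (hψs x v w)
  constructor
  · refine ⟨⟨fun z => (ψ (0, z)).symm.toLinearEquiv, continuous_mk_of_continuousFamilyAt hψ0,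
      fun z (v w : E) => ?_⟩⟩
    have h1 := hψB (0, z) ((ψ (0, z)).symm v) ((ψ (0, z)).symm w)
    rw [ContinuousLinearEquiv.apply_symm_apply, ContinuousLinearEquiv.apply_symm_apply, hH0] at h1
    exact h1.symm.trans (hB _ _ _)
  · intro Φ
    obtain ⟨φ, hφΦ⟩ : ∃ φ : Disk → Cn n ≃L[ℝ] E, ∀ z, (φ z).symm.toLinearEquiv = Φ.equiv z :=
      ⟨fun z => (show E ≃ₗ[ℝ] Cn n from Φ.equiv z).symm.toContinuousLinearEquiv, fun z => rfl⟩
    have hφ : ∀ z : Disk, ContinuousFamilyAt (fun z : Disk => u z)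
        (fun z => (φ z : Cn n →L[ℝ] E)) z := by
      refine continuousFamilyAt_of_continuous_mk (Φ.continuous_symm.congr fun q => ?_)
      rw [← hφΦ]
      rfl
    have hφB : ∀ (z : Disk) v w, B (u z) (φ z v) (φ z w) = stdSymp v w := fun z v w => by
      have h1 := Φ.symplectic z (φ z v) (φ z w)
      have h2 : ∀ v, Φ.equiv z (φ z v) = v := fun v => by
        rw [← hφΦ]; exact (φ z).symm_apply_apply v
      rw [h2, h2] at h1
      exact (hB _ _ _).trans h1.symm
    -- the trivialization over the homotopy that extends the given one
    let θ : unitInterval × Disk → Cn n ≃L[ℝ] E := fun x =>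
      ((φ x.2).trans (ψ (0, x.2)).symm).trans (ψ x)
    have hθ : ∀ x, ContinuousFamilyAt H (fun x => (θ x : Cn n →L[ℝ] E)) x := fun x => by
      have hA : Continuous fun z : Disk =>
          ((ψ (0, z)).symm : E →L[ℝ] Cn n) ∘L (φ z : Cn n →L[ℝ] E) :=
        continuous_iff_continuousAt.2 fun z => (hφ z).symm_comp (hψ0 z)
      exact ((hψ x).comp (hA.comp continuous_snd).continuousAt).congr
        (Eventually.of_forall fun y => rfl)
    have hθB : ∀ x v w, B (H x) (θ x v) (θ x w) = stdSymp v w := fun x v w => by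
      refine (hψB x _ _).trans ((hψB (0, x.2) _ _).symm.trans ?_)
      change B (H (0, x.2)) (ψ (0, x.2) ((ψ (0, x.2)).symm (φ x.2 v)))
        (ψ (0, x.2) ((ψ (0, x.2)).symm (φ x.2 w))) = _
      rw [ContinuousLinearEquiv.apply_symm_apply, ContinuousLinearEquiv.apply_symm_apply, hH0,
        hφB]
    have hθ0 : ∀ z, θ (0, z) = φ z := fun z => by ext v; simp [θ]
    -- the boundary loops of the homotopy
    obtain ⟨Λ₁, hΛ₁⟩ := exists_lagrangian_family hn hι
      (K := fun y : unitInterval × Circle => H (y.1, bdry y.2)) hwc (fun y => (hw y).symm)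
      (fun y => (hθ (y.1, bdry y.2)).comp_map
        (g := fun y : unitInterval × Circle => (y.1, bdry y.2))
        (continuous_fst.prodMk (continuous_bdry.comp continuous_snd)).continuousAt)
      (fun y v v' => (hB _ _ _).symm.trans (hθB _ v v'))
    -- the contraction of the last of these loops
    let g : unitInterval × Circle → unitInterval × Disk := fun y =>
      (1, diskSegment c (unitInterval.symm y.1, bdry y.2))
    have hg : Continuous g := continuous_const.prodMk ((continuous_diskSegment c).comp
      ((unitInterval.continuous_symm.comp continuous_fst).prodMk
        (continuous_bdry.comp continuous_snd)))
    have hwp : ∀ z, w (1, z) = w (1, 1) := fun z => hinj (by rw [hw, hw, hH1, hH1])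
    obtain ⟨Λ₂, hΛ₂⟩ := exists_lagrangian_family hn hι
      (K := fun y : unitInterval × Circle => H (g y)) (w := fun _ => w (1, 1)) continuous_const
      (fun y => (hH1 _).trans ((hw (1, 1)).trans (hH1 _)).symm)
      (fun y => (hθ (g y)).comp_map (g := g) (y₀ := y) hg.continuousAt)
      (fun y v v' => (hB _ _ _).symm.trans (hθB _ v v'))
    have h12 : ∀ z, Λ₁ (1, z) = Λ₂ (0, z) := fun z => Subtype.ext (by
      rw [hΛ₁, hΛ₂, hwp]
      simp only [g, unitInterval.symm_zero, diskSegment_one])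
    have h2 : ∀ z, Λ₂ (1, z) = Λ₂ (1, 1) := fun z => Subtype.ext (by
      rw [hΛ₂, hΛ₂]
      simp only [g, unitInterval.symm_one, diskSegment_zero])
    let Γ : C(Circle, LagrangianGrassmannian n) := Λ₁.comp (.prodMk (.const _ 0) (.id _))
    let Γ' : C(Circle, LagrangianGrassmannian n) := Λ₁.comp (.prodMk (.const _ 1) (.id _))
    have hΓ : Γ.Homotopic Γ' := ⟨⟨Λ₁, fun _ => rfl, fun _ => rfl⟩⟩
    have hΓ' : Γ'.Homotopic (.const _ (Λ₂ (1, 1))) := ⟨⟨Λ₂, fun z => (h12 z).symm, h2⟩⟩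
    refine ⟨Γ, fun z => ?_, ?_⟩
    · rw [tangentOfRange_eq hinj ((hw (0, z)).trans (hH0 _))]
      change ((Λ₁ (0, z)).1 : Set (Cn n)) = _
      rw [hΛ₁, hθ0, ← hφΦ]
      exact Set.range_comp (φ (bdry z)).symm (differential F E ι (w (0, z)))
    · obtain ⟨b, hb⟩ := exists_unitary_basis (Λ₂ (1, 1)).2
      -- For `m = 0` the model loop is the constant plane `turnedPlane b 0`.
      exact ⟨b, .const _ (Λ₂ (1, 1)), fun t => by simp [hb], hΓ.trans hΓ'⟩
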